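/- Let $(X_{ij})_{i,j\ge 1}$ be independent, identically distributed real random variables with $\mathbb{E}|X_{ij}|^4<\infty$ (the distribution need not be symmetric or centered). Write $m_r=\mathbb{E}X_{ij}^r$ for the moments and $\mu_r=\mathbb{E}(X_{ij}-m_1)^r$ for the central moments, so that $$\mu_2=m_2-m_1^2,\qquad \mu_3=m_3-3m_1m_2+2m_1^3,\qquad \mu_4=m_4-4m_1m_3+6m_1^2m_2-3m_1^4 .$$ For $n\ge 0$ let $f_4(n)=\mathbb{E}\big[(\det (X_{ij})_{1\le i,j\le n})^4\big]$, with $f_4(0)=1$; these expectations are finite. Then for all complex $t$ with $|t|\,\mu_2^2<1$ the series $F_4(t)=\sum_{n=0}^\infty \frac{t^n}{(n!)^2} f_4(n)$ converges absolutely and $$F_4(t)=\frac{e^{t(\mu_4-3\mu_2^2)}}{(1-\mu_2^2t)^5}\Big(1+\sum_{k=1}^6 p_k t^k\Big),$$ where \begin{align*} p_1&=m_1^4+6m_1^2\mu_2-2\mu_2^2+4m_1\mu_3,\\ p_2&=7m_1^4\mu_2^2-6m_1^2\mu_2^3+\mu_2^4+12m_1^3\mu_2\mu_3-8m_1\mu_2^2\mu_3+6m_1^2\mu_3^2,\\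 p_3&=2m_1\left(2m_1^3\mu_2^4-6m_1^2\mu_2^3\mu_3+2\mu_2^4\mu_3+3m_1^3\mu_2\mu_3^2-6m_1\mu_2^2\mu_3^2+2m_1^2\mu_3^3\right),\\ p_4&=m_1^2\mu_3^2\left(m_1^2\mu_3^2-6m_1^2\mu_2^3+6\mu_2^4-8m_1\mu_2^2\mu_3\right),\\ p_5&=2m_1^3\mu_2^2\mu_3^3\left(2\mu_2^2-m_1\mu_3\right),\\ p_6&=m_1^4\mu_2^4\mu_3^4 . \end{align*} -/

import Mathlib

open MeasureTheory ProbabilityTheory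

noncomputable section

namespace RandomDet

/-- The random `n × n` matrix formed by the entries `X i j`, `i, j < n`, of an infinite array of
random variables, evaluated at the outcome `ω`. -/
def randMatrix {Ω : Type*} (X : ℕ → ℕ → Ω → ℝ) (n : ℕ) (ω : Ω) : Matrix (Fin n) (Fin n) ℝ :=
  Matrix.of fun i j => X i j ω

/-- The `k`-th moment `f_k(n) = E |A|^k` of the determinant of the random `n × n` matrix `A`. -/
def detMoment {Ω : Type*} [MeasurableSpace Ω] (P : Measure Ω) (X : ℕ → ℕ → Ω → ℝ) (k n : ℕ) : ℝ :=
  ∫ ω, (randMatrix X n ω).det ^ k ∂P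

/-- The polynomials `p₁, …, p₆` in the mean `m₁` and the central moments `μ₂`, `μ₃`. -/
def p (m₁ μ₂ μ₃ : ℝ) : ℕ → ℝ
  | 1 => m₁ ^ 4 + 6 * m₁ ^ 2 * μ₂ - 2 * μ₂ ^ 2 + 4 * m₁ * μ₃
  | 2 => 7 * m₁ ^ 4 * μ₂ ^ 2 - 6 * m₁ ^ 2 * μ₂ ^ 3 + μ₂ ^ 4 + 12 * m₁ ^ 3 * μ₂ * μ₃
      - 8 * m₁ * μ₂ ^ 2 * μ₃ + 6 * m₁ ^ 2 * μ₃ ^ 2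
  | 3 => 2 * m₁ * (2 * m₁ ^ 3 * μ₂ ^ 4 - 6 * m₁ ^ 2 * μ₂ ^ 3 * μ₃ + 2 * μ₂ ^ 4 * μ₃
      + 3 * m₁ ^ 3 * μ₂ * μ₃ ^ 2 - 6 * m₁ * μ₂ ^ 2 * μ₃ ^ 2 + 2 * m₁ ^ 2 * μ₃ ^ 3)
  | 4 => m₁ ^ 2 * μ₃ ^ 2 * (m₁ ^ 2 * μ₃ ^ 2 - 6 * m₁ ^ 2 * μ₂ ^ 3 + 6 * μ₂ ^ 4
      - 8 * m₁ * μ₂ ^ 2 * μ₃)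
  | 5 => 2 * m₁ ^ 3 * μ₂ ^ 2 * μ₃ ^ 3 * (2 * μ₂ ^ 2 - m₁ * μ₃)
  | 6 => m₁ ^ 4 * μ₂ ^ 4 * μ₃ ^ 4
  | _ => 0

end RandomDet

end

noncomputable section

namespace RandomDet

open Matrix Finset

/-! The fourth power of the determinant is a polynomial of degree at most four in each entry, so
only the moments of order at most four matter. The entries may thus be replaced by independent
samples of a five-atom signed law with the same moments; positivity plays no role, and every
expectation becomes a finite sum.

With centred entries `M`, adding the constant `m` gives `det M + m * cofSum M` (`det_add_const`), so
the shifted fourth moment is a combination of the mixed moments of `det ^ (4 - k) * cofSum ^ k`.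
Both factors are affine in each row. Writing the cofactor sum as a sum over rows and integrating out
the distinguished row expresses a mixed moment by a lower one, with factor `mom 3`, and by
second-order quantities of an `n × (n + 1)` matrix. Integrating out a column of the latter leads
back to square matrices. The resulting linear recurrences close up.

Two inputs are not formal. The centred fourth moment reduces to the norm of the vector of maximal
minors, whose off-diagonal part is computed by integrating out two columns
(`matExp_cof_sq_mul_cof_sq`). The fourth moment of the sum of these minors is unchanged by sign
changes of its terms, even for an asymmetric law, so it can be averaged over random signs
(`minorSumMoment_eq`).

For generating functions normalized by `n!²` and `n! (n + 1)!`, the recurrences become one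
differential equation, giving `exp (κ t) / (1 - μ₂² t)³` in the centred case, and linear equations
solved by multiplication with the geometric series. -/

/-- A centered signed law of total mass one with finitely many atoms. -/
structure CenteredLaw (K : Type*) [Fintype K] where
  weight : K → ℝ
  value : K → ℝ
  sum_weight : ∑ k, weight k = 1
  sum_weight_mul_value : ∑ k, weight k * value k = 0

/-! ### Expectations under finite signed laws -/

namespace CenteredLaw

variable {K : Type*} [Fintype K] (ν : CenteredLaw K)

/-- The `r`-th moment of the law. -/
def mom (r : ℕ) : ℝ := ∑ k, ν.weight k * ν.value k ^ r

/-- The fourth cumulant of the law. -/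
def kappa : ℝ := ν.mom 4 - 3 * ν.mom 2 ^ 2

/-- Expectation of a function of a vector with independent entries. -/
def vecExp {n : ℕ} (F : (Fin n → ℝ) → ℝ) : ℝ :=
  ∑ σ : Fin n → K, (∏ j, ν.weight (σ j)) * F (fun j => ν.value (σ j))

/-- Expectation of a function of a matrix with independent entries. -/
def matExp {m n : ℕ} (F : (Fin m → Fin n → ℝ) → ℝ) : ℝ :=
  ∑ σ : Fin m → Fin n → K, (∏ i, ∏ j, ν.weight (σ i j)) * F (fun i j => ν.value (σ i j))

section linearity

variable {n : ℕ} {ι : Type*}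

lemma vecExp_add (F G : (Fin n → ℝ) → ℝ) :
    ν.vecExp (fun y => F y + G y) = ν.vecExp F + ν.vecExp G := by
  simp only [vecExp, mul_add, sum_add_distrib]

lemma vecExp_const_mul (c : ℝ) (F : (Fin n → ℝ) → ℝ) :
    ν.vecExp (fun y => c * F y) = c * ν.vecExp F := by
  simp only [vecExp, mul_sum]
  exact sum_congr rfl fun _ _ => by ring

lemma vecExp_succ (F : (Fin (n + 1) → ℝ) → ℝ) (i : Fin (n + 1)) :
    ν.vecExp F = ∑ k, ν.weight k *
      ν.vecExp (fun y : Fin n → ℝ => F (i.insertNth (α := fun _ => ℝ) (ν.value k) y)) := by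
  simp only [vecExp, mul_sum]
  rw [← Fintype.sum_prod_type', ← (Fin.insertNthEquiv (fun _ => K) i).sum_comp]
  refine sum_congr rfl fun σ _ => ?_
  rw [Fin.prod_univ_succAbove _ i]
  simp only [Fin.insertNthEquiv_apply, Fin.insertNth_apply_same, Fin.insertNth_apply_succAbove,
    mul_assoc]
  congr 3
  funext j
  refine Fin.succAboveCases i ?_ (fun j => ?_) j <;> simp

lemma vecExp_const (c : ℝ) : ν.vecExp (fun _ : Fin n → ℝ => c) = c := by
  induction n with
  | zero => simp [vecExp]
  | succ n ih => rw [vecExp_succ _ _ 0, ← sum_mul, ih, ν.sum_weight, one_mul]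

lemma vecExp_mul_const (c : ℝ) (F : (Fin n → ℝ) → ℝ) :
    ν.vecExp (fun y => F y * c) = ν.vecExp F * c := by
  simp only [mul_comm _ c, vecExp_const_mul]

variable {m : ℕ}

lemma matExp_add (F G : (Fin m → Fin n → ℝ) → ℝ) :
    ν.matExp (fun y => F y + G y) = ν.matExp F + ν.matExp G := by
  simp only [matExp, mul_add, sum_add_distrib]

lemma matExp_const_mul (c : ℝ) (F : (Fin m → Fin n → ℝ) → ℝ) :
    ν.matExp (fun y => c * F y) = c * ν.matExp F := by
  simp only [matExp, mul_sum]
  exact sum_congr rfl fun _ _ => by ring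

lemma matExp_sum (s : Finset ι) (F : ι → (Fin m → Fin n → ℝ) → ℝ) :
    ν.matExp (fun y => ∑ i ∈ s, F i y) = ∑ i ∈ s, ν.matExp (F i) := by
  simp only [matExp, mul_sum]
  exact sum_comm

end linearity

section peeling

variable {m n : ℕ}

/-- Integrating out the row `i` of a random matrix. -/
lemma matExp_row (F : (Fin (m + 1) → Fin n → ℝ) → ℝ) (i : Fin (m + 1)) :
    ν.matExp F = ν.matExp (fun Z : Fin m → Fin n → ℝ =>
      ν.vecExp (fun y : Fin n → ℝ => F (i.insertNth (α := fun _ => Fin n → ℝ) y Z))) := by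
  simp only [matExp, vecExp, mul_sum]
  rw [← Fintype.sum_prod_type_right', ← (Fin.insertNthEquiv (fun _ => Fin n → K) i).sum_comp]
  refine sum_congr rfl fun σ _ => ?_
  rw [Fin.prod_univ_succAbove _ i]
  simp only [Fin.insertNthEquiv_apply, Fin.insertNth_apply_same, Fin.insertNth_apply_succAbove]
  rw [← mul_assoc, mul_comm (∏ i, _)]
  congr 2
  funext j
  refine Fin.succAboveCases i ?_ (fun j => ?_) j <;> simp

lemma matExp_transpose (F : (Fin m → Fin n → ℝ) → ℝ) :
    ν.matExp F = ν.matExp (fun Z : Fin n → Fin m → ℝ => F (fun i j => Z j i)) := by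
  simp only [matExp]
  rw [← (Equiv.piComm (fun _ _ => K)).sum_comp]
  refine sum_congr rfl fun σ _ => ?_
  rw [prod_comm]
  rfl

/-- Integrating out the column `i` of a random matrix. -/
lemma matExp_col (F : (Fin m → Fin (n + 1) → ℝ) → ℝ) (i : Fin (n + 1)) :
    ν.matExp F = ν.matExp (fun Z : Fin m → Fin n → ℝ => ν.vecExp (fun z : Fin m → ℝ =>
      F (fun p => i.insertNth (α := fun _ => ℝ) (z p) (Z p)))) := by
  rw [matExp_transpose, matExp_row _ _ i, matExp_transpose]
  congr! 6 with Z z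
  funext j
  refine Fin.succAboveCases i ?_ (fun j => ?_) j <;> simp

end peeling

/-! ### Moments of linear forms in independent centred entries -/

section linearForms

variable {n : ℕ}

lemma sum_mul_cons (a : Fin (n + 1) → ℝ) (x : ℝ) (y : Fin n → ℝ) :
    ∑ j, a j * (Fin.insertNth (α := fun _ => ℝ) 0 x y) j
      = a 0 * x + ∑ j, a (Fin.succ j) * y j := by
  rw [Fin.sum_univ_succ]
  simp

lemma vecExp_linear (a : Fin n → ℝ) : ν.vecExp (fun y => ∑ j, a j * y j) = 0 := by
  induction n with
  | zero => simp [vecExp]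
  | succ n ih =>
    rw [vecExp_succ _ _ 0]
    simp only [sum_mul_cons, vecExp_add, vecExp_const, ih, add_zero]
    have : ∀ k, ν.weight k * (a 0 * ν.value k) = a 0 * (ν.weight k * ν.value k) :=
      fun k => by ring
    simp only [this, ← mul_sum, ν.sum_weight_mul_value, mul_zero]

lemma sum_weight_poly (c₀ c₁ c₂ c₃ c₄ : ℝ) :
    ∑ k, ν.weight k * (c₀ + c₁ * ν.value k + c₂ * ν.value k ^ 2 + c₃ * ν.value k ^ 3
      + c₄ * ν.value k ^ 4) = c₀ + c₂ * ν.mom 2 + c₃ * ν.mom 3 + c₄ * ν.mom 4 := by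
  have : ∀ k, ν.weight k * (c₀ + c₁ * ν.value k + c₂ * ν.value k ^ 2 + c₃ * ν.value k ^ 3
      + c₄ * ν.value k ^ 4) = c₀ * ν.weight k + c₁ * (ν.weight k * ν.value k)
      + c₂ * (ν.weight k * ν.value k ^ 2) + c₃ * (ν.weight k * ν.value k ^ 3)
      + c₄ * (ν.weight k * ν.value k ^ 4) := fun k => by ring
  simp only [this, sum_add_distrib, ← mul_sum, ν.sum_weight, ν.sum_weight_mul_value, mom]
  ring

lemma vecExp_bilinear (a b : Fin n → ℝ) :
    ν.vecExp (fun y => (∑ j, a j * y j) * (∑ j, b j * y j)) = ν.mom 2 * ∑ j, a j * b j := by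
  induction n with
  | zero => simp [vecExp]
  | succ n ih =>
    rw [vecExp_succ _ _ 0, Fin.sum_univ_succ]
    simp only [sum_mul_cons]
    have e : ∀ x : ℝ, ν.vecExp (fun y => (a 0 * x + ∑ j, a (Fin.succ j) * y j) *
        (b 0 * x + ∑ j, b (Fin.succ j) * y j)) =
        ν.mom 2 * (∑ j : Fin n, a j.succ * b j.succ) + 0 * x + (a 0 * b 0) * x ^ 2
          + 0 * x ^ 3 + 0 * x ^ 4 := by
      intro x
      rw [← ih]
      trans ν.vecExp (fun y => a 0 * x * (b 0 * x) + (a 0 * x) * ∑ j, b (Fin.succ j) * y j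
        + (b 0 * x) * ∑ j, a (Fin.succ j) * y j
        + (∑ j, a (Fin.succ j) * y j) * ∑ j, b (Fin.succ j) * y j)
      · congr 1; funext y; ring
      · simp only [vecExp_add, vecExp_const, vecExp_const_mul, vecExp_linear]
        ring
    simp only [e, sum_weight_poly]
    ring

lemma vecExp_trilinear (a b c : Fin n → ℝ) :
    ν.vecExp (fun y => (∑ j, a j * y j) * (∑ j, b j * y j) * (∑ j, c j * y j))
      = ν.mom 3 * ∑ j, a j * b j * c j := by
  induction n with
  | zero => simp [vecExp]
  | succ n ih =>
    rw [vecExp_succ _ _ 0, Fin.sum_univ_succ]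
    simp only [sum_mul_cons]
    have e : ∀ x : ℝ, ν.vecExp (fun y => (a 0 * x + ∑ j, a (Fin.succ j) * y j) *
        (b 0 * x + ∑ j, b (Fin.succ j) * y j) * (c 0 * x + ∑ j, c (Fin.succ j) * y j)) =
        ν.mom 3 * (∑ j : Fin n, a j.succ * b j.succ * c j.succ)
          + ν.mom 2 * (a 0 * (∑ j : Fin n, b j.succ * c j.succ)
            + b 0 * (∑ j : Fin n, a j.succ * c j.succ)
            + c 0 * (∑ j : Fin n, a j.succ * b j.succ)) * x + 0 * x ^ 2
          + (a 0 * b 0 * c 0) * x ^ 3 + 0 * x ^ 4 := by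
      intro x
      rw [← ih]
      trans ν.vecExp (fun y => a 0 * x * (b 0 * x) * (c 0 * x)
        + (a 0 * x * (b 0 * x)) * (∑ j, c (Fin.succ j) * y j)
        + (a 0 * x * (c 0 * x)) * (∑ j, b (Fin.succ j) * y j)
        + (b 0 * x * (c 0 * x)) * (∑ j, a (Fin.succ j) * y j)
        + (a 0 * x) * ((∑ j, b (Fin.succ j) * y j) * (∑ j, c (Fin.succ j) * y j))
        + (b 0 * x) * ((∑ j, a (Fin.succ j) * y j) * (∑ j, c (Fin.succ j) * y j))
        + (c 0 * x) * ((∑ j, a (Fin.succ j) * y j) * (∑ j, b (Fin.succ j) * y j))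
        + (∑ j, a (Fin.succ j) * y j) * (∑ j, b (Fin.succ j) * y j)
          * (∑ j, c (Fin.succ j) * y j))
      · congr 1; funext y; ring
      · simp only [vecExp_add, vecExp_const, vecExp_const_mul, vecExp_linear, vecExp_bilinear]
        ring
    simp only [e, sum_weight_poly]
    ring

/-- The third moment is absent because any cubed entry is paired with a single centred one. The
result depends on each coefficient only through its square, which later yields invariance under sign
changes. -/
lemma vecExp_pow_four (a : Fin n → ℝ) :
    ν.vecExp (fun y => (∑ j, a j * y j) ^ 4)
      = ν.kappa * ∑ j, a j ^ 4 + 3 * ν.mom 2 ^ 2 * (∑ j, a j ^ 2) ^ 2 := by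
  induction n with
  | zero => simp [vecExp]
  | succ n ih =>
    rw [vecExp_succ _ _ 0, Fin.sum_univ_succ, Fin.sum_univ_succ]
    simp only [sum_mul_cons]
    have e : ∀ x : ℝ, ν.vecExp (fun y => (a 0 * x + ∑ j, a (Fin.succ j) * y j) ^ 4) =
        (ν.kappa * ∑ j : Fin n, a j.succ ^ 4 + 3 * ν.mom 2 ^ 2 * (∑ j : Fin n, a j.succ ^ 2) ^ 2)
          + (4 * a 0 * ν.mom 3 * ∑ j : Fin n, a j.succ * a j.succ * a j.succ) * x
          + (6 * a 0 ^ 2 * ν.mom 2 * ∑ j : Fin n, a j.succ * a j.succ) * x ^ 2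
          + 0 * x ^ 3 + a 0 ^ 4 * x ^ 4 := by
      intro x
      rw [← ih]
      trans ν.vecExp (fun y => (a 0 * x) ^ 4
        + (4 * (a 0 * x) ^ 3) * (∑ j, a (Fin.succ j) * y j)
        + (6 * (a 0 * x) ^ 2) * ((∑ j, a (Fin.succ j) * y j) * (∑ j, a (Fin.succ j) * y j))
        + (4 * (a 0 * x)) * ((∑ j, a (Fin.succ j) * y j) * (∑ j, a (Fin.succ j) * y j)
          * (∑ j, a (Fin.succ j) * y j))
        + (∑ j, a (Fin.succ j) * y j) ^ 4)
      · congr 1; funext y; ring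
      · simp only [vecExp_add, vecExp_const, vecExp_const_mul, vecExp_linear, vecExp_bilinear,
          vecExp_trilinear]
        ring
    simp only [e, sum_weight_poly, ← pow_two, kappa]
    ring

end linearForms

end CenteredLaw

/-! ### Determinants, maximal minors and cofactor sums -/

section determinants

variable {m n : ℕ}

/-- The matrix `Z` without its column `i`. -/
def dropCol (Z : Fin m → Fin (n + 1) → ℝ) (i : Fin (n + 1)) : Fin m → Fin n → ℝ :=
  fun p q => Z p (i.succAbove q)

/-- The signed maximal minors of an `n × (n + 1)` matrix. -/
def cof (Z : Fin n → Fin (n + 1) → ℝ) (i : Fin (n + 1)) : ℝ :=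
  (-1) ^ (i : ℕ) * det (of (dropCol Z i))

/-- The determinant of `M` after its row `r` has been replaced by ones. -/
def rowOne (M : Fin n → Fin n → ℝ) (r : Fin n) : ℝ := det (of (Function.update M r 1))

/-- The sum of all cofactors of a square matrix. -/
def cofSum (M : Fin n → Fin n → ℝ) : ℝ := ∑ r, rowOne M r

/-- The coefficients of the sum of cofactors as a linear function of a row. -/
def cofS (Z : Fin n → Fin (n + 1) → ℝ) (j : Fin (n + 1)) : ℝ :=
  (-1) ^ (j : ℕ) * cofSum (dropCol Z j)

lemma det_insertNth (r : Fin (n + 1)) (y : Fin (n + 1) → ℝ) (Z : Fin n → Fin (n + 1) → ℝ) :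
    det (of (r.insertNth (α := fun _ => Fin (n + 1) → ℝ) y Z))
      = (-1) ^ (r : ℕ) * ∑ j, cof Z j * y j := by
  rw [det_succ_row _ r, mul_sum]
  refine sum_congr rfl fun j _ => ?_
  have : (of (r.insertNth (α := fun _ => Fin (n + 1) → ℝ) y Z)).submatrix r.succAbove j.succAbove
      = of (dropCol Z j) := by
    ext p q
    simp [dropCol]
  rw [this, cof]
  simp only [of_apply, Fin.insertNth_apply_same, pow_add]
  ring

lemma rowOne_insertNth_same (r : Fin (n + 1)) (y : Fin (n + 1) → ℝ)
    (Z : Fin n → Fin (n + 1) → ℝ) :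
    rowOne (r.insertNth (α := fun _ => Fin (n + 1) → ℝ) y Z) r
      = (-1) ^ (r : ℕ) * ∑ j, cof Z j := by
  rw [rowOne, Fin.update_insertNth, det_insertNth]
  simp

lemma dropCol_update (Z : Fin n → Fin (n + 1) → ℝ) (s : Fin n) (j : Fin (n + 1)) :
    dropCol (Function.update Z s 1) j = Function.update (dropCol Z j) s 1 := by
  funext p q
  by_cases h : p = s
  · subst h; simp [dropCol]
  · simp [dropCol, h]

lemma rowOne_insertNth_succAbove (r : Fin (n + 1)) (s : Fin n) (y : Fin (n + 1) → ℝ)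
    (Z : Fin n → Fin (n + 1) → ℝ) :
    rowOne (r.insertNth (α := fun _ => Fin (n + 1) → ℝ) y Z) (r.succAbove s)
      = (-1) ^ (r : ℕ) * ∑ j : Fin (n + 1), (-1) ^ (j : ℕ) * rowOne (dropCol Z j) s * y j := by
  rw [rowOne, ← Fin.insertNth_update, det_insertNth]
  simp only [cof, dropCol_update, rowOne]

/-- Replacing row `r` itself by ones erases `y`, while replacing any other row leaves a determinant
linear in `y`; hence an affine function of `y`. -/
lemma cofSum_insertNth (r : Fin (n + 1)) (y : Fin (n + 1) → ℝ) (Z : Fin n → Fin (n + 1) → ℝ) :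
    cofSum (r.insertNth (α := fun _ => Fin (n + 1) → ℝ) y Z) = (-1) ^ (r : ℕ) *
      (∑ j, cof Z j + ∑ j, cofS Z j * y j) := by
  rw [cofSum, Fin.sum_univ_succAbove _ r, rowOne_insertNth_same, mul_add]
  simp only [rowOne_insertNth_succAbove]
  rw [← mul_sum, sum_comm]
  simp only [cofS, cofSum, mul_sum, sum_mul]

/-- The sum of the signed minors is the determinant with a row of ones put on top. Laplace expansion
along column `i` makes it affine in that column. -/
lemma sum_cof_insertNth (i : Fin (n + 1)) (z : Fin n → ℝ) (Z : Fin n → Fin n → ℝ) :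
    ∑ j, cof (fun p => i.insertNth (α := fun _ => ℝ) (z p) (Z p)) j
      = (-1) ^ (i : ℕ) * (det (of Z) - ∑ p, rowOne Z p * z p) := by
  have h := det_insertNth 0 1 (fun p => i.insertNth (α := fun _ => ℝ) (z p) (Z p))
  simp only [Fin.val_zero, pow_zero, one_mul, Pi.one_apply, mul_one] at h
  rw [← h, det_succ_column _ i, Fin.sum_univ_succ, mul_sub]
  congr 1
  · have : (of ((0 : Fin (n + 1)).insertNth (α := fun _ => Fin (n + 1) → ℝ) 1
        fun p => i.insertNth (α := fun _ => ℝ) (z p) (Z p))).submatrix (Fin.succAbove 0)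
        i.succAbove = of Z := by
      ext p q
      simp
    rw [this]
    simp
  · rcases n with _ | n
    · simp
    rw [mul_sum, ← sum_neg_distrib]
    refine sum_congr rfl fun p _ => ?_
    have e : (of ((0 : Fin (n + 2)).insertNth (α := fun _ => Fin (n + 2) → ℝ) 1
        fun p => i.insertNth (α := fun _ => ℝ) (z p) (Z p))).submatrix (Fin.succAbove p.succ)
        i.succAbove = of ((0 : Fin (n + 1)).insertNth (α := fun _ => Fin (n + 1) → ℝ) 1
          (p.removeNth Z)) := by
      ext k q
      refine Fin.cases ?_ (fun k => ?_) k
      · simp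
      · simp [Fin.removeNth]
    have e' : rowOne Z p = (-1) ^ (p : ℕ) * ∑ j, cof (p.removeNth Z) j := by
      conv_lhs => rw [← Fin.insertNth_self_removeNth p Z]
      exact rowOne_insertNth_same p (Z p) _
    rw [e, det_insertNth, e']
    simp
    ring

/-- The map `e` lists all columns but `j`, possibly permuted, and squaring removes the sign of the
permutation. -/
lemma det_eq_of_injective {Z : Fin n → Fin (n + 1) → ℝ} {e : Fin n → Fin (n + 1)}
    (he : Function.Injective e) {j : Fin (n + 1)} (hj : ∀ q, e q ≠ j) :
    det (of fun p q => Z p (e q)) ^ 2 = det (of (dropCol Z j)) ^ 2 := by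
  choose π hπ using fun q => Fin.exists_succAbove_eq (hj q)
  have hinj : Function.Injective π := fun a b hab => he (by rw [← hπ a, ← hπ b, hab])
  let σ := Equiv.ofBijective π (Finite.injective_iff_bijective.mp hinj)
  have : (of fun p q => Z p (e q)) = (of (dropCol Z j)).submatrix id σ := by
    ext p q
    simp [dropCol, σ, hπ]
  rw [this, det_permute', mul_pow]
  rcases Int.units_eq_one_or (Equiv.Perm.sign σ) with h | h <;> simp [h]

lemma det_add_const (M : Fin n → Fin n → ℝ) (c : ℝ) :
    det (of fun i j => M i j + c) = det (of M) + c * cofSum M := by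
  -- The rows are shifted one at a time, using linearity of the determinant in each row.
  have key : ∀ s : Finset (Fin n), det (of fun i j => M i j + if i ∈ s then c else 0)
      = det (of M) + c * ∑ r ∈ s, rowOne M r := by
    intro s
    induction s using Finset.induction_on with
    | empty => simp
    | insert r s hr ih =>
      rw [sum_insert hr, mul_add, add_left_comm, ← ih]
      have e1 : (of fun i j => M i j + if i ∈ insert r s then c else 0)
          = updateRow (of fun i j => M i j + if i ∈ s then c else 0) r (M r + c • 1) := by
        ext i j
        by_cases h : i = r
        · subst h; simp
        · simp [h]
      have e2 : updateRow (of fun i j => M i j + if i ∈ s then c else 0) r (M r)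
          = of fun i j => M i j + if i ∈ s then c else 0 := by
        ext i j
        by_cases h : i = r
        · subst h; simp [hr]
        · simp [updateRow_ne h]
      rw [e1, det_updateRow_add, det_updateRow_smul, e2, add_comm]
      congr 2
      -- Once row `r` consists of ones, the shifts of the other rows are multiples of it and row
      -- operations remove them.
      refine det_eq_of_forall_row_eq_smul_add_const (fun i => if i ∈ s then c else 0) r
        (by simp [hr]) fun i j => ?_
      by_cases h : i = r
      · subst h; simp [hr]
      · simp [h]
  simpa [cofSum] using key univ

end determinants

/-! ### Recurrences for the mixed moments -/

namespace CenteredLaw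

variable {K : Type*} [Fintype K] (ν : CenteredLaw K)

/-- The mixed moment of the determinant and the sum of cofactors, of degree `k` in the latter. -/
def mixedMoment (k n : ℕ) : ℝ :=
  ν.matExp (fun M : Fin n → Fin n → ℝ => det (of M) ^ (4 - k) * cofSum M ^ k)

/-- The expectation of `|C|⁴` for the vector `C` of maximal minors of an `n × (n + 1)` matrix. -/
def minorNormMoment (n : ℕ) : ℝ :=
  ν.matExp (fun Z : Fin n → Fin (n + 1) → ℝ => (∑ i, cof Z i ^ 2) ^ 2)

/-- The fourth moment of the sum of the signed maximal minors of an `n × (n + 1)` matrix. -/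
def minorSumMoment (n : ℕ) : ℝ :=
  ν.matExp (fun Z : Fin n → Fin (n + 1) → ℝ => (∑ i, cof Z i) ^ 4)

/-- Mixed moment of quadratic functions of the maximal minors of an `n × (n + 1)` matrix. -/
def colMoment (k n : ℕ) : ℝ :=
  ν.matExp (fun Z : Fin n → Fin (n + 1) → ℝ =>
    (∑ i, det (of (dropCol Z i)) ^ (2 - k) * cofSum (dropCol Z i) ^ k) * (∑ i, cof Z i) ^ 2)

/-- Mixed moment involving the determinants with one row replaced by ones. -/
def rowOneMoment (k n : ℕ) : ℝ :=
  ν.matExp (fun M : Fin n → Fin n → ℝ => det (of M) ^ (2 - k) * cofSum M ^ k *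
    ∑ r, rowOne M r ^ 2)

variable {n : ℕ}

lemma dropCol_insertNth {m : ℕ} (i : Fin (n + 1)) (z : Fin m → ℝ) (Z : Fin m → Fin n → ℝ) :
    dropCol (fun p => i.insertNth (α := fun _ => ℝ) (z p) (Z p)) i = Z := by
  funext p q
  simp [dropCol]

lemma neg_one_pow_sq (i : ℕ) : ((-1 : ℝ) ^ i) ^ 2 = 1 := by
  rw [← pow_mul, mul_comm, pow_mul]; simp

lemma neg_one_pow_four (i : ℕ) : ((-1 : ℝ) ^ i) ^ 4 = 1 := by
  rw [← pow_mul, mul_comm, pow_mul]; norm_num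

lemma matExp_dropCol (Φ : (Fin n → Fin n → ℝ) → ℝ) (i : Fin (n + 1)) :
    ν.matExp (fun Z : Fin n → Fin (n + 1) → ℝ => Φ (dropCol Z i)) = ν.matExp Φ := by
  rw [matExp_col _ _ i]
  simp only [dropCol_insertNth, vecExp_const]

lemma matExp_dropCol_mul_sum_cof (Φ : (Fin n → Fin n → ℝ) → ℝ) :
    ν.matExp (fun Z : Fin n → Fin (n + 1) → ℝ =>
        ∑ i : Fin (n + 1), (-1) ^ (i : ℕ) * Φ (dropCol Z i) * ∑ j, cof Z j)
      = (n + 1) * ν.matExp (fun M => Φ M * det (of M)) := by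
  rw [matExp_sum]
  trans ∑ _i : Fin (n + 1), ν.matExp (fun M => Φ M * det (of M))
  · refine sum_congr rfl fun i _ => ?_
    rw [matExp_col _ _ i]
    congr 1
    funext Z
    simp only [dropCol_insertNth, sum_cof_insertNth]
    trans ν.vecExp (fun z => Φ Z * det (of Z) + (-Φ Z) * ∑ p, rowOne Z p * z p)
    · congr 1
      funext z
      linear_combination (Φ Z * (det (of Z) - ∑ p, rowOne Z p * z p)) * neg_one_pow_sq i
    · simp only [vecExp_add, vecExp_const, vecExp_const_mul, vecExp_linear, mul_zero, add_zero]
  · simp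

/-- Given the matrix without column `i`, the sum of minors is, up to sign, the determinant minus a
centred linear form in that column; its second moment is the squared mean plus the variance. -/
lemma matExp_sum_dropCol_mul_sum_cof_sq (Φ : (Fin n → Fin n → ℝ) → ℝ) :
    ν.matExp (fun Z : Fin n → Fin (n + 1) → ℝ => (∑ i, Φ (dropCol Z i)) * (∑ j, cof Z j) ^ 2)
      = (n + 1) * (ν.matExp (fun M => Φ M * det (of M) ^ 2)
        + ν.mom 2 * ν.matExp (fun M => Φ M * ∑ r, rowOne M r ^ 2)) := by
  simp only [sum_mul]
  rw [matExp_sum]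
  trans ∑ _i : Fin (n + 1), (ν.matExp (fun M => Φ M * det (of M) ^ 2)
        + ν.mom 2 * ν.matExp (fun M => Φ M * ∑ r, rowOne M r ^ 2))
  · refine sum_congr rfl fun i _ => ?_
    rw [matExp_col _ _ i, ← matExp_const_mul, ← matExp_add]
    congr 1
    funext Z
    simp only [dropCol_insertNth, sum_cof_insertNth]
    trans ν.vecExp (fun z => Φ Z * det (of Z) ^ 2
      + (-2 * Φ Z * det (of Z)) * ∑ p, rowOne Z p * z p
      + Φ Z * ((∑ p, rowOne Z p * z p) * ∑ p, rowOne Z p * z p))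
    · congr 1
      funext z
      linear_combination (Φ Z * (det (of Z) - ∑ p, rowOne Z p * z p) ^ 2) * neg_one_pow_sq i
    · simp only [vecExp_add, vecExp_const, vecExp_const_mul, vecExp_linear, vecExp_bilinear]
      simp only [← pow_two]
      ring
  · simp
    ring

lemma colMoment_eq (k n : ℕ) (hk : k ≤ 2) :
    ν.colMoment k n = (n + 1) * (ν.mixedMoment k n + ν.mom 2 * ν.rowOneMoment k n) := by
  rw [colMoment, matExp_sum_dropCol_mul_sum_cof_sq ν
    (fun M => det (of M) ^ (2 - k) * cofSum M ^ k), mixedMoment, rowOneMoment]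
  congr! 4 with M
  rw [show 4 - k = (2 - k) + 2 by omega, pow_add]
  ring

/-- Used when integrating out the distinguished row gives a result independent of its position. -/
lemma sum_matExp_const {m : ℕ} (F : Fin (m + 1) → (Fin (m + 1) → Fin (m + 1) → ℝ) → ℝ)
    (G : (Fin m → Fin (m + 1) → ℝ) → ℝ)
    (h : ∀ r Z, ν.vecExp (fun y =>
      F r (r.insertNth (α := fun _ => Fin (m + 1) → ℝ) y Z)) = G Z) :
    ν.matExp (fun M => ∑ r, F r M) = (m + 1) * ν.matExp G := by
  rw [matExp_sum]
  trans ∑ _r : Fin (m + 1), ν.matExp G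
  · refine sum_congr rfl fun r _ => ?_
    rw [matExp_row _ _ r]
    simp only [h]
  · simp

lemma rowOneMoment_zero (k : ℕ) : ν.rowOneMoment k 0 = 0 := by
  simp [rowOneMoment, matExp]

lemma cof_sq (Z : Fin n → Fin (n + 1) → ℝ) (j : Fin (n + 1)) :
    cof Z j * cof Z j = det (of (dropCol Z j)) ^ 2 := by
  rw [cof]; linear_combination det (of (dropCol Z j)) ^ 2 * neg_one_pow_sq j

lemma cof_mul_cofS (Z : Fin n → Fin (n + 1) → ℝ) (j : Fin (n + 1)) :
    cof Z j * cofS Z j = det (of (dropCol Z j)) * cofSum (dropCol Z j) := by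
  rw [cof, cofS]
  linear_combination det (of (dropCol Z j)) * cofSum (dropCol Z j) * neg_one_pow_sq j

lemma cofS_sq (Z : Fin n → Fin (n + 1) → ℝ) (j : Fin (n + 1)) :
    cofS Z j * cofS Z j = cofSum (dropCol Z j) ^ 2 := by
  rw [cofS]; linear_combination cofSum (dropCol Z j) ^ 2 * neg_one_pow_sq j

/-- This and its two analogues integrate out a row, whereas `colMoment_eq` integrates out a column;
together they determine both families. -/
lemma rowOneMoment_zero_succ (n : ℕ) :
    ν.rowOneMoment 0 (n + 1) = (n + 1) * (ν.mom 2 * ν.colMoment 0 n) := by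
  simp only [rowOneMoment, mul_sum]
  rw [sum_matExp_const ν _ (fun Z => ν.mom 2 * ((∑ i, det (of (dropCol Z i)) ^ (2 - 0) *
    cofSum (dropCol Z i) ^ 0) * (∑ i, cof Z i) ^ 2))]
  · rw [matExp_const_mul, colMoment]
  intro r Z
  simp only [det_insertNth, cofSum_insertNth, rowOne_insertNth_same]
  set s := ∑ j, cof Z j
  trans ν.vecExp (fun y => ((∑ j, cof Z j * y j) * (∑ j, cof Z j * y j)) * s ^ 2)
  · congr 1
    funext y
    -- The product has four factors, each carrying the sign `(-1) ^ r`, so the signs cancel.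
    linear_combination ((∑ j, cof Z j * y j) ^ 2 * s ^ 2) * neg_one_pow_four r
  · simp only [vecExp_mul_const, vecExp_bilinear, cof_sq]
    simp
    ring

lemma rowOneMoment_one_succ (n : ℕ) :
    ν.rowOneMoment 1 (n + 1) = (n + 1) * (ν.mom 2 * ν.colMoment 1 n) := by
  simp only [rowOneMoment, mul_sum]
  rw [sum_matExp_const ν _ (fun Z => ν.mom 2 * ((∑ i, det (of (dropCol Z i)) ^ (2 - 1) *
    cofSum (dropCol Z i) ^ 1) * (∑ i, cof Z i) ^ 2))]
  · rw [matExp_const_mul, colMoment]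
  intro r Z
  simp only [det_insertNth, cofSum_insertNth, rowOne_insertNth_same]
  set s := ∑ j, cof Z j
  trans ν.vecExp (fun y => ((∑ j, cof Z j * y j) * (∑ j, cofS Z j * y j)) * s ^ 2
    + s ^ 3 * ∑ j, cof Z j * y j)
  · congr 1
    funext y
    linear_combination ((∑ j, cof Z j * y j) * (s + ∑ j, cofS Z j * y j) * s ^ 2)
      * neg_one_pow_four r
  · simp only [vecExp_add, vecExp_mul_const, vecExp_const_mul, vecExp_linear, vecExp_bilinear,
      cof_mul_cofS]
    simp
    ring

lemma rowOneMoment_two_succ (n : ℕ) :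
    ν.rowOneMoment 2 (n + 1) = (n + 1) * (ν.minorSumMoment n + ν.mom 2 * ν.colMoment 2 n) := by
  simp only [rowOneMoment, mul_sum]
  rw [sum_matExp_const ν _ (fun Z => (∑ i, cof Z i) ^ 4 +
    ν.mom 2 * ((∑ i, det (of (dropCol Z i)) ^ (2 - 2) *
    cofSum (dropCol Z i) ^ 2) * (∑ i, cof Z i) ^ 2))]
  · rw [matExp_add, matExp_const_mul, colMoment, minorSumMoment]
  intro r Z
  simp only [det_insertNth, cofSum_insertNth, rowOne_insertNth_same]
  set s := ∑ j, cof Z j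
  trans ν.vecExp (fun y => s ^ 4 + (2 * s ^ 3) * (∑ j, cofS Z j * y j)
    + ((∑ j, cofS Z j * y j) * (∑ j, cofS Z j * y j)) * s ^ 2)
  · congr 1
    funext y
    linear_combination ((s + ∑ j, cofS Z j * y j) ^ 2 * s ^ 2) * neg_one_pow_four r
  · simp only [vecExp_add, vecExp_const, vecExp_mul_const, vecExp_const_mul, vecExp_linear,
      vecExp_bilinear, cofS_sq]
    simp
    ring

/-- Trilinear expectations produce a lower mixed moment. -/
lemma matExp_sum_mul_sum_cof (Φ : (Fin n → Fin n → ℝ) → ℝ)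
    (a : (Fin n → Fin (n + 1) → ℝ) → Fin (n + 1) → ℝ)
    (h : ∀ Z j, a Z j = (-1) ^ (j : ℕ) * Φ (dropCol Z j)) :
    ν.matExp (fun Z : Fin n → Fin (n + 1) → ℝ => (∑ i, a Z i) * ∑ j, cof Z j)
      = (n + 1) * ν.matExp (fun M => Φ M * det (of M)) := by
  rw [← matExp_dropCol_mul_sum_cof]
  simp only [h, sum_mul]

/-- One factor `cofSum` is split into its rows; the row `r` of a summand then occurs only in the
remaining three factors, so moments up to the third suffice. The same device serves for the higher
mixed moments. -/
lemma mixedMoment_one_succ (n : ℕ) :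
    ν.mixedMoment 1 (n + 1) = (n + 1) * ((n + 1) * (ν.mom 3 * ν.mixedMoment 0 n)) := by
  simp only [mixedMoment]
  conv_lhs => simp only [cofSum, pow_one, mul_sum]
  rw [sum_matExp_const ν _ (fun Z => ν.mom 3 *
    ((∑ j, cof Z j * cof Z j * cof Z j) * ∑ j, cof Z j))]
  · rw [matExp_const_mul, matExp_sum_mul_sum_cof ν (fun M => det (of M) ^ 3)]
    · simp only [← pow_succ, pow_zero, mul_one]
      ring
    · intro Z j
      rw [cof_sq, cof]
      ring
  intro r Z
  simp only [det_insertNth, rowOne_insertNth_same]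
  set s := ∑ j, cof Z j
  trans ν.vecExp (fun y =>
    ((∑ j, cof Z j * y j) * (∑ j, cof Z j * y j) * (∑ j, cof Z j * y j)) * s)
  · congr 1
    funext y
    linear_combination ((∑ j, cof Z j * y j) ^ 3 * s) * neg_one_pow_four r
  · simp only [vecExp_mul_const, vecExp_trilinear]
    ring

lemma mixedMoment_two_succ (n : ℕ) :
    ν.mixedMoment 2 (n + 1) = (n + 1) * (ν.mom 2 * ν.colMoment 0 n
      + (n + 1) * (ν.mom 3 * ν.mixedMoment 1 n)) := by
  simp only [mixedMoment]
  have e : ∀ M : Fin (n + 1) → Fin (n + 1) → ℝ, det (of M) ^ (4 - 2) * cofSum M ^ 2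
      = ∑ r, det (of M) ^ 2 * cofSum M * rowOne M r := by
    intro M
    rw [← mul_sum, ← cofSum]
    ring
  conv_lhs => simp only [e]
  rw [sum_matExp_const ν _ (fun Z => ν.mom 2 * ((∑ i, det (of (dropCol Z i)) ^ (2 - 0) *
      cofSum (dropCol Z i) ^ 0) * (∑ i, cof Z i) ^ 2) + ν.mom 3 *
    ((∑ j, cof Z j * cof Z j * cofS Z j) * ∑ j, cof Z j))]
  · rw [matExp_add, matExp_const_mul, matExp_const_mul,
      matExp_sum_mul_sum_cof ν (fun M => det (of M) ^ 2 * cofSum M), colMoment]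
    · have : ∀ M : Fin n → Fin n → ℝ, det (of M) ^ 2 * cofSum M * det (of M)
          = det (of M) ^ (4 - 1) * cofSum M ^ 1 := fun M => by ring
      simp only [this]
      ring
    · intro Z j
      rw [cof_sq, cofS]
      ring
  intro r Z
  simp only [det_insertNth, cofSum_insertNth, rowOne_insertNth_same]
  set s := ∑ j, cof Z j
  trans ν.vecExp (fun y => ((∑ j, cof Z j * y j) * (∑ j, cof Z j * y j)) * s ^ 2
    + ((∑ j, cof Z j * y j) * (∑ j, cof Z j * y j) * (∑ j, cofS Z j * y j)) * s)
  · congr 1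
    funext y
    linear_combination ((∑ j, cof Z j * y j) ^ 2 * (s + ∑ j, cofS Z j * y j) * s)
      * neg_one_pow_four r
  · simp only [vecExp_add, vecExp_mul_const, vecExp_bilinear, vecExp_trilinear, cof_sq]
    simp
    ring

lemma mixedMoment_three_succ (n : ℕ) :
    ν.mixedMoment 3 (n + 1) = (n + 1) * (2 * ν.mom 2 * ν.colMoment 1 n
      + (n + 1) * (ν.mom 3 * ν.mixedMoment 2 n)) := by
  simp only [mixedMoment]
  have e : ∀ M : Fin (n + 1) → Fin (n + 1) → ℝ, det (of M) ^ (4 - 3) * cofSum M ^ 3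
      = ∑ r, det (of M) * cofSum M ^ 2 * rowOne M r := by
    intro M
    rw [← mul_sum, ← cofSum]
    ring
  conv_lhs => simp only [e]
  rw [sum_matExp_const ν _ (fun Z => (2 * ν.mom 2) * ((∑ i, det (of (dropCol Z i)) ^ (2 - 1) *
      cofSum (dropCol Z i) ^ 1) * (∑ i, cof Z i) ^ 2) + ν.mom 3 *
    ((∑ j, cof Z j * cofS Z j * cofS Z j) * ∑ j, cof Z j))]
  · rw [matExp_add, matExp_const_mul, matExp_const_mul,
      matExp_sum_mul_sum_cof ν (fun M => det (of M) * cofSum M ^ 2), colMoment]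
    · have : ∀ M : Fin n → Fin n → ℝ, det (of M) * cofSum M ^ 2 * det (of M)
          = det (of M) ^ (4 - 2) * cofSum M ^ 2 := fun M => by ring
      simp only [this]
      ring
    · intro Z j
      rw [mul_assoc, cofS_sq, cof]
      ring
  intro r Z
  simp only [det_insertNth, cofSum_insertNth, rowOne_insertNth_same]
  set s := ∑ j, cof Z j
  trans ν.vecExp (fun y => s ^ 3 * (∑ j, cof Z j * y j)
    + ((∑ j, cof Z j * y j) * (∑ j, cofS Z j * y j)) * (2 * s ^ 2)
    + ((∑ j, cof Z j * y j) * (∑ j, cofS Z j * y j) * (∑ j, cofS Z j * y j)) * s)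
  · congr 1
    funext y
    linear_combination ((∑ j, cof Z j * y j) * (s + ∑ j, cofS Z j * y j) ^ 2 * s)
      * neg_one_pow_four r
  · simp only [vecExp_add, vecExp_mul_const, vecExp_const_mul, vecExp_linear, vecExp_bilinear,
      vecExp_trilinear, cof_mul_cofS]
    simp
    ring

lemma mixedMoment_four_succ (n : ℕ) :
    ν.mixedMoment 4 (n + 1) = (n + 1) * (ν.minorSumMoment n + 3 * ν.mom 2 * ν.colMoment 2 n
      + (n + 1) * (ν.mom 3 * ν.mixedMoment 3 n)) := by
  simp only [mixedMoment]
  have e : ∀ M : Fin (n + 1) → Fin (n + 1) → ℝ, det (of M) ^ (4 - 4) * cofSum M ^ 4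
      = ∑ r, cofSum M ^ 3 * rowOne M r := by
    intro M
    rw [← mul_sum, ← cofSum]
    ring
  conv_lhs => simp only [e]
  rw [sum_matExp_const ν _ (fun Z => (∑ i, cof Z i) ^ 4
    + (3 * ν.mom 2) * ((∑ i, det (of (dropCol Z i)) ^ (2 - 2) *
      cofSum (dropCol Z i) ^ 2) * (∑ i, cof Z i) ^ 2) + ν.mom 3 *
    ((∑ j, cofS Z j * cofS Z j * cofS Z j) * ∑ j, cof Z j))]
  · rw [matExp_add, matExp_add, matExp_const_mul, matExp_const_mul,
      matExp_sum_mul_sum_cof ν (fun M => cofSum M ^ 3), colMoment, minorSumMoment]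
    · have : ∀ M : Fin n → Fin n → ℝ, cofSum M ^ 3 * det (of M)
          = det (of M) ^ (4 - 3) * cofSum M ^ 3 := fun M => by ring
      simp only [this]
      ring
    · intro Z j
      rw [cofS_sq, cofS]
      ring
  intro r Z
  simp only [cofSum_insertNth, rowOne_insertNth_same]
  set s := ∑ j, cof Z j
  trans ν.vecExp (fun y => s ^ 4 + (3 * s ^ 3) * (∑ j, cofS Z j * y j)
    + ((∑ j, cofS Z j * y j) * (∑ j, cofS Z j * y j)) * (3 * s ^ 2)
    + ((∑ j, cofS Z j * y j) * (∑ j, cofS Z j * y j) * (∑ j, cofS Z j * y j)) * s)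
  · congr 1
    funext y
    linear_combination ((s + ∑ j, cofS Z j * y j) ^ 3 * s) * neg_one_pow_four r
  · simp only [vecExp_add, vecExp_mul_const, vecExp_const_mul, vecExp_linear, vecExp_bilinear,
      vecExp_trilinear, vecExp_const, cofS_sq]
    simp
    ring

/-! ### The centred fourth moment and the norm of the vector of minors -/

lemma matExp_sum_cof_pow_four (n : ℕ) :
    ν.matExp (fun Z : Fin n → Fin (n + 1) → ℝ => ∑ i, cof Z i ^ 4)
      = (n + 1) * ν.mixedMoment 0 n := by
  rw [matExp_sum]
  trans ∑ _i : Fin (n + 1), ν.mixedMoment 0 n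
  · refine sum_congr rfl fun i _ => ?_
    simp only [cof, mul_pow, neg_one_pow_four, one_mul]
    rw [matExp_dropCol ν (fun M => det (of M) ^ 4), mixedMoment]
    simp
  · simp

lemma mixedMoment_zero_succ (n : ℕ) :
    ν.mixedMoment 0 (n + 1) = ν.kappa * ((n + 1) * ν.mixedMoment 0 n)
      + 3 * ν.mom 2 ^ 2 * ν.minorNormMoment n := by
  rw [← matExp_sum_cof_pow_four, minorNormMoment, ← matExp_const_mul, ← matExp_const_mul,
    ← matExp_add, mixedMoment, matExp_row _ _ 0]
  congr 1
  funext Z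
  rw [← vecExp_pow_four]
  simp only [det_insertNth, Fin.val_zero, Nat.sub_zero, pow_zero, one_mul, mul_one]

/-- Of the two columns named, each minor contains exactly one. Expanded along it, both minors are,
up to sign, linear forms with the same coefficients, the minors of the remaining matrix, but in
independent columns. -/
lemma matExp_cof_sq_mul_cof_sq (i : Fin (n + 2)) (j : Fin (n + 1)) :
    ν.matExp (fun Z : Fin (n + 1) → Fin (n + 2) → ℝ => cof Z i ^ 2 * cof Z (i.succAbove j) ^ 2)
      = ν.mom 2 ^ 2 * ν.minorNormMoment n := by
  rw [matExp_col _ _ i, matExp_col _ _ j, matExp_transpose, minorNormMoment, ← matExp_const_mul]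
  congr 1
  funext W
  have hdet : ∀ z : Fin (n + 1) → ℝ,
      det (of fun p => j.insertNth (α := fun _ => ℝ) (z p) fun q => W q p) ^ 2
        = (∑ p, cof W p * z p) * ∑ p, cof W p * z p := by
    intro z
    have : (of fun p => j.insertNth (α := fun _ => ℝ) (z p) fun q => W q p)
        = (of (j.insertNth (α := fun _ => Fin (n + 1) → ℝ) z W))ᵀ := by
      ext p q
      refine Fin.succAboveCases j ?_ (fun q => ?_) q <;> simp
    rw [this, det_transpose, det_insertNth, mul_pow, neg_one_pow_sq]
    ring
  -- Putting `i` at position `j` of `i.succAbove` enumerates, out of order, all columns other than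
  -- `i.succAbove j`.
  have hinj : Function.Injective (Function.update i.succAbove j i) := by
    intro a b hab
    by_cases ha : a = j <;> by_cases hb : b = j
    · rw [ha, hb]
    · subst ha
      rw [Function.update_self, Function.update_of_ne hb] at hab
      exact absurd hab.symm (Fin.succAbove_ne _ _)
    · subst hb
      rw [Function.update_self, Function.update_of_ne ha] at hab
      exact absurd hab (Fin.succAbove_ne _ _)
    · rw [Function.update_of_ne ha, Function.update_of_ne hb] at hab
      exact Fin.succAbove_right_injective hab
  have hne : ∀ q, Function.update i.succAbove j i q ≠ i.succAbove j := by
    intro q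
    by_cases hq : q = j
    · subst hq
      rw [Function.update_self]
      exact (Fin.succAbove_ne _ _).symm
    · rw [Function.update_of_ne hq]
      exact fun h => hq (Fin.succAbove_right_injective h)
  have hmixed : ∀ z' z : Fin (n + 1) → ℝ,
      det (of (dropCol (fun p => i.insertNth (α := fun _ => ℝ) (z p)
        (j.insertNth (α := fun _ => ℝ) (z' p) fun q => W q p)) (i.succAbove j))) ^ 2
        = (∑ p, cof W p * z p) * ∑ p, cof W p * z p := by
    intro z' z
    rw [← hdet, ← det_eq_of_injective hinj hne]
    congr 3
    funext p q
    refine Fin.succAboveCases j ?_ (fun q => ?_) q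
    · simp
    · rw [Function.update_of_ne (Fin.succAbove_ne _ _)]
      simp
  have hcof : ∀ (Z : Fin (n + 1) → Fin (n + 2) → ℝ) k,
      cof Z k ^ 2 = det (of (dropCol Z k)) ^ 2 := fun Z k => by rw [pow_two, cof_sq]
  simp only [hcof, hmixed, dropCol_insertNth, hdet, vecExp_const_mul, vecExp_bilinear,
    vecExp_mul_const]
  simp only [← pow_two]
  ring

lemma minorNormMoment_zero : ν.minorNormMoment 0 = ν.mixedMoment 0 0 := by
  simp [minorNormMoment, mixedMoment, matExp, cof]

lemma minorNormMoment_succ (n : ℕ) :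
    ν.minorNormMoment (n + 1) = (n + 2) * ν.mixedMoment 0 (n + 1)
      + (n + 2) * ((n + 1) * (ν.mom 2 ^ 2 * ν.minorNormMoment n)) := by
  have e : ∀ Z : Fin (n + 1) → Fin (n + 2) → ℝ, (∑ i, cof Z i ^ 2) ^ 2
      = ∑ i, cof Z i ^ 4 + ∑ i, ∑ j : Fin (n + 1), cof Z i ^ 2 * cof Z (i.succAbove j) ^ 2 := by
    intro Z
    rw [pow_two, sum_mul, ← sum_add_distrib]
    refine sum_congr rfl fun i _ => ?_
    rw [Fin.sum_univ_succAbove _ i, mul_add, mul_sum]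
    ring
  rw [minorNormMoment]
  simp only [e]
  rw [matExp_add, matExp_sum_cof_pow_four, matExp_sum]
  simp only [matExp_sum, matExp_cof_sq_mul_cof_sq]
  simp
  ring

/-! ### Sign invariance and the sum of the minors -/

/-- Only the existence of coefficients independent of row `r` is needed: it makes `vecExp_pow_four`
applicable to that row. -/
lemma exists_sum_cof_eq (r : Fin n) (Z : Fin n → Fin (n + 1) → ℝ) :
    ∃ γ : Fin (n + 1) → ℝ, ∀ y, ∑ j, cof (Function.update Z r y) j = ∑ j, γ j * y j := by
  let A : Matrix (Fin (n + 1)) (Fin (n + 1)) ℝ :=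
    of ((0 : Fin (n + 1)).insertNth (α := fun _ => Fin (n + 1) → ℝ) 1 Z)
  refine ⟨fun j => cramer Aᵀ (fun k => if j = k then 1 else 0) r.succ, fun y => ?_⟩
  have h := det_insertNth 0 1 (Function.update Z r y)
  simp only [Fin.val_zero, pow_zero, one_mul, Pi.one_apply, mul_one] at h
  have hA : of ((0 : Fin (n + 1)).insertNth (α := fun _ => Fin (n + 1) → ℝ) 1
      (Function.update Z r y)) = A.updateRow r.succ y := by
    ext p q
    refine Fin.cases ?_ (fun p => ?_) p
    · rw [updateRow_ne (Fin.succ_ne_zero r).symm]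
      rfl
    · by_cases hp : p = r
      · subst hp; simp
      · simp [A, updateRow_ne, hp]
  rw [← h, hA, ← cramer_transpose_apply, LinearMap.pi_apply_eq_sum_univ (cramer Aᵀ) y,
    Finset.sum_apply]
  refine sum_congr rfl fun j _ => ?_
  rw [Pi.smul_apply, smul_eq_mul, mul_comm]

lemma matExp_update {m : ℕ} (F : (Fin m → Fin n → ℝ) → ℝ) (r : Fin m) :
    ν.matExp F = ν.matExp (fun Z => ν.vecExp (fun y => F (Function.update Z r y))) := by
  obtain _ | m := m
  · exact r.elim0
  rw [matExp_row _ _ r, matExp_row _ (fun Z => ν.vecExp (fun y => F (Function.update Z r y))) r]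
  simp only [Fin.update_insertNth, vecExp_const]

/-- Multiplying all rows by the same signs does not change the fourth moment. -/
lemma minorSumMoment_eq_of_sign (ε : Fin (n + 1) → ℝ) (hε : ∀ j, ε j ^ 2 = 1) :
    ν.matExp (fun Z : Fin n → Fin (n + 1) → ℝ => (∑ j, cof Z j * ε j) ^ 4)
      = ν.minorSumMoment n := by
  -- The signs are applied to one row at a time; conditionally on the others, the fourth moment sees
  -- only even powers of the coefficients.
  have key : ∀ s : Finset (Fin n), ν.matExp (fun Z : Fin n → Fin (n + 1) → ℝ =>
      (∑ j, cof (fun i => if i ∈ s then ε * Z i else Z i) j) ^ 4) = ν.minorSumMoment n := by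
    intro s
    induction s using Finset.induction_on with
    | empty => simp [minorSumMoment]
    | insert r s hr ih =>
      rw [← ih, matExp_update _ _ r, matExp_update _ (fun Z => (∑ j, cof _ j) ^ 4) r]
      congr 1
      funext Z
      obtain ⟨γ, hγ⟩ := exists_sum_cof_eq r (fun i => if i ∈ s then ε * Z i else Z i)
      have e1 : ∀ y, (fun i => if i ∈ insert r s then ε * Function.update Z r y i
          else Function.update Z r y i)
          = Function.update (fun i => if i ∈ s then ε * Z i else Z i) r (ε * y) := by
        intro y
        funext i
        by_cases h : i = r
        · subst h; simp
        · simp [h]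
      have e2 : ∀ y, (fun i => if i ∈ s then ε * Function.update Z r y i
          else Function.update Z r y i)
          = Function.update (fun i => if i ∈ s then ε * Z i else Z i) r y := by
        intro y
        funext i
        by_cases h : i = r
        · subst h; simp [hr]
        · simp [h]
      simp only [e1, e2, hγ, Pi.mul_apply, ← mul_assoc]
      rw [vecExp_pow_four, vecExp_pow_four]
      have h4 : ∀ j, ε j ^ 4 = 1 := fun j => by rw [show 4 = 2 * 2 by rfl, pow_mul, hε, one_pow]
      simp only [mul_pow, h4, hε, mul_one]
  rw [← key univ]
  congr 1
  funext Z
  have h1 := det_insertNth 0 1 (fun i => ε * Z i)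
  have h2 := det_insertNth 0 ε Z
  simp only [Fin.val_zero, pow_zero, one_mul, Pi.one_apply, mul_one] at h1 h2
  -- The signs on the rows of `Z` are moved to whole columns; since `ε j ^ 2 = 1`, the top row of
  -- ones becomes `ε`.
  have h3 : of ((0 : Fin (n + 1)).insertNth (α := fun _ => Fin (n + 1) → ℝ) 1
      (fun i => ε * Z i)) = of fun p q => ε q *
        of ((0 : Fin (n + 1)).insertNth (α := fun _ => Fin (n + 1) → ℝ) ε Z) p q := by
    ext p q
    refine Fin.cases ?_ (fun p => ?_) p
    · simp [← pow_two, hε]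
    · simp
  rw [h3, det_mul_row, h2] at h1
  have h4 : (∏ j, ε j) ^ 4 = 1 := by
    rw [← prod_pow]
    exact prod_eq_one fun j _ => by rw [show 4 = 2 * 2 by rfl, pow_mul, hε, one_pow]
  simp only [mem_univ, if_true]
  rw [← h1, mul_pow, h4, one_mul]

/-- The Rademacher law. -/
def rademacher : CenteredLaw Bool where
  weight := fun _ => 1 / 2
  value := fun b => if b then 1 else -1
  sum_weight := by norm_num
  sum_weight_mul_value := by norm_num

/-- By sign invariance the moment equals its average over Rademacher signs. These have second moment
1 and fourth cumulant -2, whence the coefficients 3 and -2. -/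
lemma minorSumMoment_eq (n : ℕ) :
    ν.minorSumMoment n = 3 * ν.minorNormMoment n - 2 * ((n + 1) * ν.mixedMoment 0 n) := by
  have h : rademacher.vecExp (fun ε : Fin (n + 1) → ℝ =>
      ν.matExp (fun Z : Fin n → Fin (n + 1) → ℝ => (∑ j, cof Z j * ε j) ^ 4))
      = ν.minorSumMoment n := by
    rw [← rademacher.vecExp_const (n := n + 1) (ν.minorSumMoment n)]
    refine sum_congr rfl fun σ _ => ?_
    congr 1
    refine ν.minorSumMoment_eq_of_sign _ fun j => ?_
    simp only [rademacher]
    split_ifs <;> norm_num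
  have h' : rademacher.vecExp (fun ε : Fin (n + 1) → ℝ =>
      ν.matExp (fun Z : Fin n → Fin (n + 1) → ℝ => (∑ j, cof Z j * ε j) ^ 4))
      = ν.matExp (fun Z : Fin n → Fin (n + 1) → ℝ =>
        rademacher.vecExp (fun ε => (∑ j, cof Z j * ε j) ^ 4)) := by
    simp only [vecExp, matExp_sum, matExp_const_mul]
  have hk : rademacher.kappa = -2 := by simp [kappa, mom, rademacher]; norm_num
  have h2 : rademacher.mom 2 = 1 := by simp [mom, rademacher]
  rw [← h, h']
  simp only [vecExp_pow_four, hk, h2]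
  rw [matExp_add, matExp_const_mul, matExp_const_mul, matExp_sum_cof_pow_four, ← minorNormMoment]
  ring

end CenteredLaw

/-! ### Generating functions and their convergence -/

section powerSeries

open PowerSeries

/-- The power series with coefficients `a n / n!²`. -/
def sqGen (a : ℕ → ℝ) : ℝ⟦X⟧ := mk fun n => a n / (n.factorial : ℝ) ^ 2

/-- The power series with coefficients `a n / (n! (n + 1)!)`. -/
def shiftGen (a : ℕ → ℝ) : ℝ⟦X⟧ := mk fun n => a n / ((n.factorial : ℝ) * (n + 1).factorial)

lemma sqGen_eq_X_mul {a b c : ℕ → ℝ} (r : ℝ) (h₀ : a 0 = 0)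
    (h : ∀ n : ℕ, a (n + 1) = (n + 1) * (b n + (n + 1) * (r * c n))) :
    sqGen a = X * (shiftGen b + C r * sqGen c) := by
  ext n
  rcases n with _ | n
  · simp [sqGen, h₀]
  · have : (n.factorial : ℝ) ≠ 0 := by positivity
    simp only [sqGen, shiftGen, coeff_succ_X_mul, map_add, coeff_C_mul, coeff_mk, h,
      Nat.factorial_succ]
    push_cast
    field_simp

/-- Combines a column step for `a` with a row step for `c`; when `d` involves `a` again, this is a
linear equation for `shiftGen a`. -/
lemma shiftGen_eq_add {a b c d : ℕ → ℝ} (r : ℝ)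
    (h : ∀ n : ℕ, a n = (n + 1) * (b n + r * c n)) (h₀ : c 0 = 0)
    (h' : ∀ n : ℕ, c (n + 1) = (n + 1) * d n) :
    shiftGen a = sqGen b + C r * (X * shiftGen d) := by
  ext n
  rcases n with _ | n
  · simp [sqGen, shiftGen, h, h₀]
  · have : (n.factorial : ℝ) ≠ 0 := by positivity
    simp only [sqGen, shiftGen, coeff_succ_X_mul, map_add, coeff_C_mul, coeff_mk, h, h',
      Nat.factorial_succ]
    push_cast
    field_simp

lemma shiftGen_add (a b : ℕ → ℝ) :
    shiftGen (fun n => a n + b n) = shiftGen a + shiftGen b := by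
  ext n; simp [shiftGen, add_div]

lemma shiftGen_const_mul (r : ℝ) (a : ℕ → ℝ) :
    shiftGen (fun n => r * a n) = C r * shiftGen a := by
  ext n; simp [shiftGen, mul_div_assoc]

lemma shiftGen_succ_mul (a : ℕ → ℝ) :
    shiftGen (fun n => (n + 1) * a n) = sqGen a := by
  ext n
  have : (n.factorial : ℝ) ≠ 0 := by positivity
  simp only [sqGen, shiftGen, coeff_mk, Nat.factorial_succ]
  push_cast
  field_simp

/-- Differentiation cancels one factor `n + 1` of `(n + 1)!²`, which accounts for the normalization
`n! (n + 1)!`. -/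
lemma derivative_sqGen {a b : ℕ → ℝ} (h : ∀ n, a (n + 1) = b n) :
    derivative ℝ (sqGen a) = shiftGen b := by
  ext n
  have : (n.factorial : ℝ) ≠ 0 := by positivity
  simp only [coeff_derivative, sqGen, shiftGen, coeff_mk, h, Nat.factorial_succ]
  push_cast
  field_simp

/-- The power series of `exp (r x)`. -/
def expSeries (r : ℝ) : ℝ⟦X⟧ := mk fun n => r ^ n / n.factorial

/-- The power series of `1 / (1 - r x)`. -/
def geomSeries (r : ℝ) : ℝ⟦X⟧ := mk fun n => r ^ n

lemma derivative_expSeries (r : ℝ) : derivative ℝ (expSeries r) = C r * expSeries r := by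
  ext n
  have : (n.factorial : ℝ) ≠ 0 := by positivity
  simp only [coeff_derivative, expSeries, coeff_C_mul, coeff_mk, Nat.factorial_succ]
  push_cast
  field_simp
  ring

lemma geomSeries_mul (r : ℝ) : geomSeries r * (1 - C r * X) = 1 := by
  ext n
  rcases n with _ | n
  · simp [geomSeries]
  · rw [mul_sub, mul_one, mul_left_comm, map_sub, coeff_C_mul, coeff_succ_mul_X]
    simp [geomSeries, pow_succ, coeff_one]
    ring

lemma mul_eq_one_of_derivative {f g a : ℝ⟦X⟧} (hf : derivative ℝ f = a * f)
    (hg : derivative ℝ g = -(a * g)) (h : constantCoeff f * constantCoeff g = 1) :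
    f * g = 1 := by
  refine derivative.ext ?_ (by simpa using h)
  rw [Derivation.leibniz, hf, hg, Derivation.map_one_eq_zero]
  simp only [smul_eq_mul]
  ring

lemma eq_expSeries_mul_geomSeries {f : ℝ⟦X⟧} {r c : ℝ}
    (hf : derivative ℝ f = (C r + 3 * C c * geomSeries c) * f) (h : constantCoeff f = 1) :
    f = expSeries r * geomSeries c ^ 3 := by
  have hg := geomSeries_mul c
  have hq : derivative ℝ (1 - C c * X : ℝ⟦X⟧) = - C c := by
    rw [map_sub, Derivation.leibniz]
    simp
  -- The inverse of the expected solution satisfies the opposite equation, so its product with `f`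
  -- is constant.
  have h₁ : f * (expSeries (-r) * (1 - C c * X) ^ 3) = 1 := by
    refine mul_eq_one_of_derivative hf ?_ ?_
    · rw [Derivation.leibniz, Derivation.leibniz_pow, hq, derivative_expSeries]
      simp only [smul_eq_mul, nsmul_eq_mul, map_neg]
      push_cast
      linear_combination (3 * C c * expSeries (-r) * (1 - C c * X) ^ 2) * hg
    · simp [h, expSeries]
  have h₂ : expSeries r * expSeries (-r) = 1 := by
    refine mul_eq_one_of_derivative (derivative_expSeries r) ?_ (by simp [expSeries])
    rw [derivative_expSeries]
    simp
  have hg3 : geomSeries c ^ 3 * (1 - C c * X) ^ 3 = 1 := by rw [← mul_pow, hg, one_pow]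
  calc f = f * (expSeries r * expSeries (-r)) * (geomSeries c ^ 3 * (1 - C c * X) ^ 3) := by
        rw [h₂, hg3, mul_one, mul_one]
    _ = (f * (expSeries (-r) * (1 - C c * X) ^ 3)) * (expSeries r * geomSeries c ^ 3) := by ring
    _ = _ := by rw [h₁, one_mul]

/-- The power series `f` converges absolutely at `t`, with sum `z`. -/
def SumsTo (f : ℝ⟦X⟧) (t z : ℂ) : Prop :=
  Summable (fun n => ‖((coeff n f : ℝ) : ℂ) * t ^ n‖) ∧ HasSum (fun n => ((coeff n f : ℝ) : ℂ) * t ^ n) z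

namespace SumsTo

variable {f g : ℝ⟦X⟧} {t z z' : ℂ}

lemma add (hf : SumsTo f t z) (hg : SumsTo g t z') : SumsTo (f + g) t (z + z') := by
  have e : ∀ n, ((coeff n (f + g) : ℝ) : ℂ) * t ^ n = ((coeff n f : ℝ) : ℂ) * t ^ n + ((coeff n g : ℝ) : ℂ) * t ^ n := by
    intro n; rw [map_add]; push_cast; ring
  simp only [SumsTo, e]
  exact ⟨(hf.1.add hg.1).of_nonneg_of_le (fun _ => norm_nonneg _) fun _ => norm_add_le _ _,
    hf.2.add hg.2⟩

lemma mul (hf : SumsTo f t z) (hg : SumsTo g t z') : SumsTo (f * g) t (z * z') := by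
  have e : ∀ n, ((coeff n (f * g) : ℝ) : ℂ) * t ^ n
      = ∑ kl ∈ antidiagonal n, (((coeff kl.1 f : ℝ) : ℂ) * t ^ kl.1) * (((coeff kl.2 g : ℝ) : ℂ) * t ^ kl.2) := by
    intro n
    rw [coeff_mul]
    push_cast
    rw [sum_mul]
    refine sum_congr rfl fun kl hkl => ?_
    rw [← mem_antidiagonal.mp hkl, pow_add]
    ring
  simp only [SumsTo, e]
  have hs := summable_norm_sum_mul_antidiagonal_of_summable_norm hf.1 hg.1
  refine ⟨hs, ?_⟩
  rw [← hf.2.tsum_eq, ← hg.2.tsum_eq,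
    tsum_mul_tsum_eq_tsum_sum_antidiagonal_of_summable_norm hf.1 hg.1]
  exact hs.of_norm.hasSum

lemma monomial (k : ℕ) (r : ℝ) (t : ℂ) : SumsTo (C r * X ^ k) t (r * t ^ k) := by
  have e : ∀ n, n ≠ k → ((coeff n (C r * X ^ k) : ℝ) : ℂ) * t ^ n = 0 := by
    intro n hn
    simp [coeff_X_pow, hn]
  have hk : ((coeff k (C r * X ^ k) : ℝ) : ℂ) * t ^ k = r * t ^ k := by simp [coeff_X_pow]
  refine ⟨summable_of_ne_finset_zero (s := {k}) fun n hn => ?_, ?_⟩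
  · rw [e n (by simpa using hn), norm_zero]
  · have := hasSum_single (f := fun n => ((coeff n (C r * X ^ k) : ℝ) : ℂ) * t ^ n) k e
    simp only [hk] at this
    exact this

lemma one (t : ℂ) : SumsTo 1 t 1 := by simpa using monomial 0 1 t

lemma pow (hf : SumsTo f t z) (k : ℕ) : SumsTo (f ^ k) t (z ^ k) := by
  induction k with
  | zero => simpa using one t
  | succ k ih => simpa only [pow_succ] using ih.mul hf

lemma sum {ι : Type*} (s : Finset ι) {f : ι → ℝ⟦X⟧} {z : ι → ℂ}
    (h : ∀ i, SumsTo (f i) t (z i)) : SumsTo (∑ i ∈ s, f i) t (∑ i ∈ s, z i) := by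
  classical
  induction s using Finset.induction_on with
  | empty => simpa using monomial 0 0 t
  | insert i s hi ih =>
    rw [sum_insert hi, sum_insert hi]
    exact (h i).add ih

lemma expSeries (r : ℝ) (t : ℂ) : SumsTo (expSeries r) t (Complex.exp (t * r)) := by
  have e : ∀ n, ((coeff n (RandomDet.expSeries r) : ℝ) : ℂ) * t ^ n
      = ((n.factorial : ℂ)⁻¹) • (t * r) ^ n := by
    intro n
    simp only [RandomDet.expSeries, coeff_mk, smul_eq_mul]
    push_cast
    rw [mul_pow]
    ring
  simp only [SumsTo, e]
  refine ⟨NormedSpace.norm_expSeries_summable' (t * r : ℂ), ?_⟩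
  rw [Complex.exp_eq_exp_ℂ]
  exact NormedSpace.exp_series_hasSum_exp' (t * r : ℂ)

lemma geomSeries {r : ℝ} {t : ℂ} (h : ‖(r : ℂ) * t‖ < 1) :
    SumsTo (geomSeries r) t (1 - r * t)⁻¹ := by
  have e : ∀ n, ((coeff n (RandomDet.geomSeries r) : ℝ) : ℂ) * t ^ n = (r * t) ^ n := by
    intro n
    simp [RandomDet.geomSeries, mul_pow]
  simp only [SumsTo, e]
  exact ⟨summable_norm_geometric_of_norm_lt_one h, hasSum_geometric_of_norm_lt_one h⟩

end SumsTo

end powerSeries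

/-! ### Solving the recurrences -/

namespace CenteredLaw

open PowerSeries

variable {K : Type*} [Fintype K] (ν : CenteredLaw K)

lemma mixedMoment_zero_right (k : ℕ) (hk : k ≠ 0) : ν.mixedMoment k 0 = 0 := by
  simp [mixedMoment, matExp, cofSum, hk]

lemma mixedMoment_zero_zero : ν.mixedMoment 0 0 = 1 := by
  simp [mixedMoment, matExp]

lemma shiftGen_minorNormMoment :
    shiftGen ν.minorNormMoment = geomSeries (ν.mom 2 ^ 2) * sqGen (ν.mixedMoment 0) := by
  have h : shiftGen ν.minorNormMoment = sqGen (ν.mixedMoment 0)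
      + C (ν.mom 2 ^ 2) * (X * shiftGen ν.minorNormMoment) := by
    -- The factor `n` makes the truncated index `n - 1` harmless at `n = 0`.
    refine shiftGen_eq_add (c := fun n => n * ν.minorNormMoment (n - 1)) _ (fun n => ?_)
      (by simp) (fun n => by simp)
    rcases n with _ | n
    · simp [minorNormMoment_zero]
    · rw [minorNormMoment_succ]
      simp
      ring
  linear_combination geomSeries (ν.mom 2 ^ 2) * h
    - shiftGen ν.minorNormMoment * geomSeries_mul (ν.mom 2 ^ 2)

lemma sqGen_mixedMoment_zero :
    sqGen (ν.mixedMoment 0) = expSeries ν.kappa * geomSeries (ν.mom 2 ^ 2) ^ 3 := by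
  refine eq_expSeries_mul_geomSeries ?_ (by simp [sqGen, mixedMoment_zero_zero])
  rw [derivative_sqGen ν.mixedMoment_zero_succ, shiftGen_add, shiftGen_const_mul,
    shiftGen_const_mul, shiftGen_succ_mul, shiftGen_minorNormMoment]
  simp only [map_mul, map_ofNat]
  ring

lemma shiftGen_minorSumMoment :
    shiftGen ν.minorSumMoment = 3 * shiftGen ν.minorNormMoment
      - 2 * sqGen (ν.mixedMoment 0) := by
  have : ν.minorSumMoment = fun n => 3 * ν.minorNormMoment n
      + (-2) * ((n + 1) * ν.mixedMoment 0 n) := by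
    funext n
    rw [minorSumMoment_eq]
    ring
  rw [this, shiftGen_add, shiftGen_const_mul, shiftGen_const_mul, shiftGen_succ_mul]
  simp only [map_neg, map_ofNat]
  ring

/-- The fourth moment of the determinant of a random matrix with mean `m`. -/
def shiftedMoment (m : ℝ) (n : ℕ) : ℝ :=
  ν.matExp (fun M : Fin n → Fin n → ℝ => (Matrix.det (Matrix.of fun i j => M i j + m)) ^ 4)

lemma shiftedMoment_eq (m : ℝ) (n : ℕ) :
    ν.shiftedMoment m n = ν.mixedMoment 0 n + 4 * m * ν.mixedMoment 1 n
      + 6 * m ^ 2 * ν.mixedMoment 2 n + 4 * m ^ 3 * ν.mixedMoment 3 n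
      + m ^ 4 * ν.mixedMoment 4 n := by
  simp only [mixedMoment, ← matExp_const_mul, ← matExp_add, shiftedMoment, det_add_const]
  congr 1
  funext M
  ring

theorem sqGen_shiftedMoment (m : ℝ) :
    sqGen (ν.shiftedMoment m) = expSeries ν.kappa * geomSeries (ν.mom 2 ^ 2) ^ 5 *
      (1 + ∑ k ∈ Finset.Icc 1 6, C (p m (ν.mom 2) (ν.mom 3) k) * X ^ k) := by
  have hg := geomSeries_mul (ν.mom 2 ^ 2)
  have h₀ := ν.sqGen_mixedMoment_zero
  have hN := ν.shiftGen_minorNormMoment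
  have hS := ν.shiftGen_minorSumMoment
  have w₁ : sqGen (ν.mixedMoment 1) = X * (C (ν.mom 3) * sqGen (ν.mixedMoment 0)) := by
    have := sqGen_eq_X_mul (b := fun n => 0 * (0 : ℝ)) (ν.mom 3)
      (ν.mixedMoment_zero_right 1 one_ne_zero) (fun n => by rw [mixedMoment_one_succ, zero_mul,
        zero_add])
    rwa [shiftGen_const_mul, map_zero, zero_mul, zero_add] at this
  have w₂ := sqGen_eq_X_mul (ν.mom 3) (ν.mixedMoment_zero_right 2 two_ne_zero)
    ν.mixedMoment_two_succ
  have w₃ := sqGen_eq_X_mul (ν.mom 3) (ν.mixedMoment_zero_right 3 three_ne_zero)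
    ν.mixedMoment_three_succ
  have w₄ := sqGen_eq_X_mul (ν.mom 3) (ν.mixedMoment_zero_right 4 four_ne_zero)
    ν.mixedMoment_four_succ
  have c₀ := shiftGen_eq_add (ν.mom 2) (fun n => ν.colMoment_eq 0 n (by norm_num))
    (ν.rowOneMoment_zero 0) ν.rowOneMoment_zero_succ
  have c₁ := shiftGen_eq_add (ν.mom 2) (fun n => ν.colMoment_eq 1 n (by norm_num))
    (ν.rowOneMoment_zero 1) ν.rowOneMoment_one_succ
  have c₂ := shiftGen_eq_add (ν.mom 2) (fun n => ν.colMoment_eq 2 n (by norm_num))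
    (ν.rowOneMoment_zero 2) ν.rowOneMoment_two_succ
  have hF : sqGen (ν.shiftedMoment m) = sqGen (ν.mixedMoment 0)
      + 4 * C m * sqGen (ν.mixedMoment 1) + 6 * C m ^ 2 * sqGen (ν.mixedMoment 2)
      + 4 * C m ^ 3 * sqGen (ν.mixedMoment 3) + C m ^ 4 * sqGen (ν.mixedMoment 4) := by
    have : 4 * C m = C (4 * m) ∧ 6 * C m ^ 2 = C (6 * m ^ 2) ∧ 4 * C m ^ 3 = C (4 * m ^ 3)
      ∧ C m ^ 4 = C (m ^ 4) := by simp only [map_mul, map_pow, map_ofNat, and_self]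
    rw [this.1, this.2.1, this.2.2.1, this.2.2.2]
    ext n
    simp only [map_add, coeff_C_mul, sqGen, coeff_mk, shiftedMoment_eq]
    ring
  have hsum : ∑ k ∈ Finset.Icc 1 6, C (p m (ν.mom 2) (ν.mom 3) k) * X ^ k
      = ∑ k ∈ Finset.range 6, C (p m (ν.mom 2) (ν.mom 3) (k + 1)) * X ^ (k + 1) := by
    rw [Finset.range_eq_Ico, Finset.sum_Ico_add' (fun k => C (p m (ν.mom 2) (ν.mom 3) k) * X ^ k)]
    rfl
  rw [hF, hsum]
  simp only [Finset.sum_range_succ, Finset.sum_range_zero, p, zero_add]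
  simp only [shiftGen_add, shiftGen_const_mul, map_add, map_sub, map_mul, map_pow, map_ofNat]
    at w₁ w₂ w₃ w₄ c₀ c₁ c₂ hg ⊢
  set g := geomSeries (ν.mom 2 ^ 2)
  set E := expSeries ν.kappa
  set a := (C m : ℝ⟦X⟧)
  set b := (C (ν.mom 2) : ℝ⟦X⟧)
  set d := (C (ν.mom 3) : ℝ⟦X⟧)
  rw [h₀] at w₁ hN hS
  rw [w₁] at w₂ c₁
  -- In `c₀`, `c₁` and `c₂` the unknown reappears with factor `b ^ 2 * X`; multiplying by `g`, the
  -- inverse of `1 - b ^ 2 * X`, solves for it.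
  have c₀' : shiftGen (ν.colMoment 0) = g * (E * g ^ 3) := by
    rw [h₀] at c₀
    linear_combination g * c₀ - shiftGen (ν.colMoment 0) * hg
  have c₁' : shiftGen (ν.colMoment 1) = g * (X * (d * (E * g ^ 3))) := by
    linear_combination g * c₁ - shiftGen (ν.colMoment 1) * hg
  rw [c₀'] at w₂
  rw [c₁', w₂] at w₃
  have c₂' : shiftGen (ν.colMoment 2) = g * (sqGen (ν.mixedMoment 2)
      + b * (X * shiftGen ν.minorSumMoment)) := by
    linear_combination g * c₂ - shiftGen (ν.colMoment 2) * hg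
  rw [hN] at hS
  rw [w₂, hS] at c₂'
  rw [c₂', hS, w₃] at w₄
  -- Only the powers 3 and 4 of `g` occur in the five mixed series; over the common factor `g ^ 5`
  -- their coefficients assemble into the polynomial.
  have g4 : g ^ 4 = g ^ 5 * (1 - b ^ 2 * X) := by linear_combination -g ^ 4 * hg
  have g3 : g ^ 3 = g ^ 5 * (1 - b ^ 2 * X) ^ 2 := by
    linear_combination -(g ^ 3 + g ^ 4 * (1 - b ^ 2 * X)) * hg
  rw [h₀, w₁, w₂, w₃, w₄]
  linear_combination E * (1 + 4 * a * d * X + 6 * a ^ 2 * (d * X) ^ 2 + 4 * a ^ 3 * (d * X) ^ 3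
      + a ^ 4 * ((d * X) ^ 4 - 2 * X)) * g3
    + E * (6 * a ^ 2 * b * X + 12 * a ^ 3 * b * d * X ^ 2
      + a ^ 4 * (3 * X - 6 * b ^ 2 * X ^ 2 + 6 * b * d ^ 2 * X ^ 3)) * g4

end CenteredLaw

/-! ### From random variables to a finite signed law -/

lemma prod_perm_eq_prod_pow {n : ℕ} (A : Fin n → Fin n → ℝ) (σ : Fin 4 → Equiv.Perm (Fin n)) :
    ∏ k, ∏ i, A (σ k i) i = ∏ i, ∏ j, A i j ^ ∑ k, if σ k j = i then 1 else 0 := by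
  simp_rw [← prod_pow_eq_pow_sum]
  rw [prod_comm]
  conv_rhs => rw [prod_comm]
  refine prod_congr rfl fun j _ => ?_
  rw [prod_comm]
  refine prod_congr rfl fun k _ => ?_
  simp

/-- Grouping equal entries leaves a product over independent entries with exponents at most four,
whose expectation needs only the first four moments. -/
lemma det_pow_four {n : ℕ} (A : Fin n → Fin n → ℝ) :
    Matrix.det (Matrix.of A) ^ 4 = ∑ σ : Fin 4 → Equiv.Perm (Fin n),
      (∏ k, ((Equiv.Perm.sign (σ k) : ℤ) : ℝ)) *
        ∏ i, ∏ j, A i j ^ ∑ k, if σ k j = i then 1 else 0 := by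
  rw [Matrix.det_apply', Fintype.sum_pow]
  refine sum_congr rfl fun σ _ => ?_
  rw [prod_mul_distrib, ← prod_perm_eq_prod_pow]
  rfl

lemma sum_ite_le_four {n : ℕ} (σ : Fin 4 → Equiv.Perm (Fin n)) (i j : Fin n) :
    (∑ k, if σ k j = i then 1 else 0) ≤ 4 := by
  refine (sum_le_card_nsmul univ _ 1 fun k _ => ?_).trans (by simp)
  split_ifs <;> norm_num

lemma iIndepFun_integrable_prod {Ω ι : Type*} [Fintype ι] [MeasurableSpace Ω] {P : Measure Ω}
    {X : ι → Ω → ℝ} (hX : iIndepFun X P) (mX : ∀ i, AEMeasurable (X i) P) {f : ι → ℝ → ℝ}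
    (mf : ∀ i, Measurable (f i)) (hf : ∀ i, Integrable (fun ω => f i (X i ω)) P) :
    Integrable (fun ω => ∏ i, f i (X i ω)) P := by
  have := hX.isProbabilityMeasure
  have h : Integrable (fun x : ι → ℝ => ∏ i, f i (x i)) (P.map fun ω i => X i ω) := by
    have : ∀ i, IsProbabilityMeasure (P.map (X i)) :=
      fun i => Measure.isProbabilityMeasure_map (mX i)
    rw [hX.map_fun_eq_pi_map mX]
    exact Integrable.fintype_prod fun i =>
      (integrable_map_measure (mf i).aestronglyMeasurable (mX i)).mpr (hf i)
  exact (integrable_map_measure h.aestronglyMeasurable (aemeasurable_pi_lambda _ mX)).mp h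

namespace CenteredLaw

lemma matExp_prod {K : Type*} [Fintype K] (ν : CenteredLaw K) {m n : ℕ}
    (f : Fin m → Fin n → ℝ → ℝ) :
    ν.matExp (fun M : Fin m → Fin n → ℝ => ∏ i, ∏ j, f i j (M i j))
      = ∏ i, ∏ j, ∑ k, ν.weight k * f i j (ν.value k) := by
  simp only [matExp, Fintype.prod_sum, ← prod_mul_distrib]

end CenteredLaw

/-- Finitely many moments are realized by a finite signed law. -/
lemma exists_weights (N : ℕ) (m : ℕ → ℝ) :
    ∃ w : Fin N → ℝ, ∀ r < N, ∑ k, w k * ((k : ℕ) : ℝ) ^ r = m r := by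
  let V := Matrix.vandermonde fun k : Fin N => ((k : ℕ) : ℝ)
  have hV : IsUnit V.det := isUnit_iff_ne_zero.mpr <|
    Matrix.det_vandermonde_ne_zero_iff.mpr (Nat.cast_injective.comp Fin.val_injective)
  refine ⟨Matrix.vecMul (fun r : Fin N => m r) V⁻¹, fun r hr => ?_⟩
  have h : Matrix.vecMul (Matrix.vecMul (fun r : Fin N => m r) V⁻¹) V = fun r : Fin N => m r := by
    rw [Matrix.vecMul_vecMul, Matrix.nonsing_inv_mul _ hV, Matrix.vecMul_one]
  exact congrFun h ⟨r, hr⟩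

lemma exists_centeredLaw (m : ℕ → ℝ) (h₀ : m 0 = 1) :
    ∃ ν : CenteredLaw (Fin 5), ∀ r ≤ 4, ∑ k, ν.weight k * (ν.value k + m 1) ^ r = m r := by
  obtain ⟨w, hw⟩ := exists_weights 5 m
  have hw₀ : ∑ k, w k = 1 := by simpa [h₀] using hw 0 (by norm_num)
  -- The atoms are 0, …, 4 translated by the mean; adding `m 1` back recovers the Vandermonde nodes.
  refine ⟨⟨w, fun k => ((k : ℕ) : ℝ) - m 1, hw₀, ?_⟩, fun r hr => ?_⟩
  · simp only [mul_sub, sum_sub_distrib, ← sum_mul, hw₀]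
    simpa [sub_eq_zero] using hw 1 (by norm_num)
  · simpa using hw r (by omega)

section bridge

variable {Ω : Type*} [MeasurableSpace Ω] {P : Measure Ω} [IsProbabilityMeasure P]

lemma integrable_pow_of_memLp {X : Ω → ℝ} (h : MemLp X 4 P) {r : ℕ} (hr : r ≤ 4) :
    Integrable (fun ω => X ω ^ r) P := by
  have h' : MemLp X (r : ENNReal) P := h.mono_exponent (by exact_mod_cast hr)
  refine (integrable_norm_iff (h.1.pow r)).mp ?_
  simpa [norm_pow] using h'.integrable_norm_pow'

lemma centralMoment_eq_sum {X : Ω → ℝ} (h : MemLp X 4 P) {r : ℕ} (hr : r ≤ 4) :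
    centralMoment X r P = ∑ k ∈ range (r + 1),
      moment X k P * (-moment X 1 P) ^ (r - k) * r.choose k := by
  have h₁ : P[X] = moment X 1 P := by simp [moment]
  have e : ∀ ω, ((X - fun _ : Ω => P[X]) ^ r : Ω → ℝ) ω = ∑ k ∈ range (r + 1),
      X ω ^ k * ((-moment X 1 P) ^ (r - k) * r.choose k) := by
    intro ω
    rw [h₁, Pi.pow_apply, Pi.sub_apply, sub_eq_add_neg, add_pow]
    exact sum_congr rfl fun _ _ => by ring
  simp only [centralMoment, e]
  rw [integral_finsetSum]
  · refine sum_congr rfl fun k _ => ?_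
    rw [integral_mul_const, moment_def, mul_assoc]
    rfl
  · intro k hk
    exact (integrable_pow_of_memLp h (by have := mem_range.mp hk; omega)).mul_const _

lemma CenteredLaw.mom_eq_sum {K : Type*} [Fintype K] (ν : CenteredLaw K) (a : ℝ) (r : ℕ) :
    ν.mom r = ∑ k ∈ range (r + 1),
      (∑ l, ν.weight l * (ν.value l + a) ^ k) * (-a) ^ (r - k) * r.choose k := by
  simp only [sum_mul]
  rw [sum_comm, mom]
  refine sum_congr rfl fun l _ => ?_
  rw [show ν.value l = (ν.value l + a) + -a by ring, add_pow, mul_sum]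
  simp only [add_neg_cancel_right]
  exact sum_congr rfl fun _ _ => by ring

variable {X : ℕ → ℕ → Ω → ℝ}

lemma integrable_and_integral_prod_pow (hindep : iIndepFun (fun ij : ℕ × ℕ => X ij.1 ij.2) P)
    (hident : ∀ i j, IdentDistrib (X i j) (X 0 0) P P) (hmoment : MemLp (X 0 0) 4 P)
    {n : ℕ} (e : Fin n → Fin n → ℕ) (he : ∀ i j, e i j ≤ 4) :
    Integrable (fun ω => ∏ i : Fin n, ∏ j : Fin n, X i j ω ^ e i j) P ∧
      ∫ ω, ∏ i : Fin n, ∏ j : Fin n, X i j ω ^ e i j ∂P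
        = ∏ i, ∏ j, moment (X 0 0) (e i j) P := by
  have hinj : Function.Injective (fun ij : Fin n × Fin n => ((ij.1 : ℕ), (ij.2 : ℕ))) := by
    rintro ⟨i, j⟩ ⟨i', j'⟩ h
    simpa [Fin.ext_iff] using h
  have hi := hindep.precomp hinj
  have hm : ∀ ij : Fin n × Fin n, AEMeasurable (X ij.1 ij.2) P :=
    fun ij => (hident _ _).aemeasurable_fst
  have hpow : ∀ (i j r : ℕ), IdentDistrib (fun ω => X i j ω ^ r) (fun ω => X 0 0 ω ^ r) P P :=
    fun i j r => (hident i j).comp (measurable_id.pow_const r)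
  simp only [← Fintype.prod_prod_type']
  constructor
  · refine iIndepFun_integrable_prod (f := fun ij x => x ^ e ij.1 ij.2) hi hm
      (fun ij => measurable_id.pow_const _) fun ij => ?_
    exact (hpow ij.1 ij.2 _).integrable_iff.mpr (integrable_pow_of_memLp hmoment (he _ _))
  · refine (hi.integral_fun_prod_comp (f := fun ij x => x ^ e ij.1 ij.2) hm fun ij =>
      (measurable_id.pow_const _).aestronglyMeasurable).trans ?_
    exact prod_congr rfl fun ij _ => (hpow ij.1 ij.2 _).integral_eq

lemma integrable_det_pow_four (hindep : iIndepFun (fun ij : ℕ × ℕ => X ij.1 ij.2) P)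
    (hident : ∀ i j, IdentDistrib (X i j) (X 0 0) P P) (hmoment : MemLp (X 0 0) 4 P) (n : ℕ) :
    Integrable (fun ω => (randMatrix X n ω).det ^ 4) P := by
  simp only [randMatrix, det_pow_four]
  exact integrable_finsetSum _ fun σ _ => (integrable_and_integral_prod_pow hindep hident hmoment
    _ (sum_ite_le_four σ)).1.const_mul _

lemma detMoment_four_eq {K : Type*} [Fintype K] (ν : CenteredLaw K) {a : ℝ}
    (hν : ∀ r ≤ 4, ∑ k, ν.weight k * (ν.value k + a) ^ r = moment (X 0 0) r P)
    (hindep : iIndepFun (fun ij : ℕ × ℕ => X ij.1 ij.2) P)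
    (hident : ∀ i j, IdentDistrib (X i j) (X 0 0) P P) (hmoment : MemLp (X 0 0) 4 P) (n : ℕ) :
    detMoment P X 4 n = ν.shiftedMoment a n := by
  simp only [detMoment, randMatrix, det_pow_four, CenteredLaw.shiftedMoment]
  rw [integral_finsetSum _ fun σ _ => (integrable_and_integral_prod_pow hindep hident hmoment
    _ (sum_ite_le_four σ)).1.const_mul _, CenteredLaw.matExp_sum]
  refine sum_congr rfl fun σ _ => ?_
  rw [integral_const_mul, CenteredLaw.matExp_const_mul,
    (integrable_and_integral_prod_pow hindep hident hmoment _ (sum_ite_le_four σ)).2,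
    ν.matExp_prod fun i j x => (x + a) ^ ∑ k, if σ k j = i then 1 else 0]
  simp only [fun i j => hν _ (sum_ite_le_four σ i j)]

end bridge

end RandomDet

end

/-! ### The generating function of the fourth moments -/

theorem theorem1 {Ω : Type*} [MeasurableSpace Ω] (P : Measure Ω) [IsProbabilityMeasure P]
    (X : ℕ → ℕ → Ω → ℝ)
    (hindep : iIndepFun (fun ij : ℕ × ℕ => X ij.1 ij.2) P)
    (hident : ∀ i j, IdentDistrib (X i j) (X 0 0) P P)
    (hmoment : MemLp (X 0 0) 4 P)
    (m : ℕ → ℝ) (hm : ∀ r, m r = moment (X 0 0) r P)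
    (μ : ℕ → ℝ) (hμ : ∀ r, μ r = centralMoment (X 0 0) r P) :
    (∀ n, Integrable (fun ω => (RandomDet.randMatrix X n ω).det ^ 4) P) ∧
    (∀ t : ℂ, ‖t‖ * μ 2 ^ 2 < 1 →
      HasSum (fun n : ℕ => t ^ n / (n.factorial : ℂ) ^ 2 * (RandomDet.detMoment P X 4 n : ℂ))
        (Complex.exp (t * ((μ 4 - 3 * μ 2 ^ 2 : ℝ) : ℂ)) / (1 - (μ 2 : ℂ) ^ 2 * t) ^ 5 *
          (1 + ∑ k ∈ Finset.Icc 1 6, (RandomDet.p (m 1) (μ 2) (μ 3) k : ℂ) * t ^ k))) ∧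
    μ 2 = m 2 - m 1 ^ 2 ∧
    μ 3 = m 3 - 3 * m 1 * m 2 + 2 * m 1 ^ 3 ∧
    μ 4 = m 4 - 4 * m 1 * m 3 + 6 * m 1 ^ 2 * m 2 - 3 * m 1 ^ 4 := by
  have hm₀ : m 0 = 1 := by simp [hm, moment]
  have hμm : ∀ r ≤ 4, μ r = ∑ k ∈ Finset.range (r + 1),
      m k * (-m 1) ^ (r - k) * r.choose k := by
    intro r hr
    rw [hμ, RandomDet.centralMoment_eq_sum hmoment hr]
    simp only [hm]
  refine ⟨RandomDet.integrable_det_pow_four hindep hident hmoment, fun t ht => ?_, ?_, ?_, ?_⟩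
  · obtain ⟨ν, hν⟩ := RandomDet.exists_centeredLaw m hm₀
    have hmom : ∀ r ≤ 4, ν.mom r = μ r := by
      intro r hr
      rw [hμm r hr, ν.mom_eq_sum (m 1)]
      refine Finset.sum_congr rfl fun k hk => ?_
      rw [hν k (by have := Finset.mem_range.mp hk; omega)]
    have hgen := ν.sqGen_shiftedMoment (m 1)
    rw [RandomDet.CenteredLaw.kappa, hmom 2 (by norm_num), hmom 3 (by norm_num),
      hmom 4 le_rfl] at hgen
    -- The assumption on `t` is exactly convergence of the geometric series; the other factors are
    -- entire.
    have ht' : ‖((μ 2 ^ 2 : ℝ) : ℂ) * t‖ < 1 := by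
      rw [norm_mul, Complex.norm_real, Real.norm_of_nonneg (sq_nonneg _), mul_comm]
      exact ht
    have hsum := (((RandomDet.SumsTo.expSeries (μ 4 - 3 * μ 2 ^ 2) t).mul
      ((RandomDet.SumsTo.geomSeries ht').pow 5)).mul ((RandomDet.SumsTo.one t).add
        (RandomDet.SumsTo.sum (Finset.Icc 1 6) fun k =>
          RandomDet.SumsTo.monomial k (RandomDet.p (m 1) (μ 2) (μ 3) k) t))).2
    rw [← hgen] at hsum
    convert hsum using 1
    · funext n
      rw [RandomDet.detMoment_four_eq ν (a := m 1) (fun r hr => (hν r hr).trans (hm r))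
        hindep hident hmoment, RandomDet.sqGen, PowerSeries.coeff_mk]
      push_cast
      ring
    · push_cast
      rw [div_eq_mul_inv, inv_pow]
  · rw [hμm 2 (by norm_num)]
    simp [Finset.sum_range_succ, hm₀]
    ring
  · rw [hμm 3 (by norm_num)]
    simp [Finset.sum_range_succ, hm₀, Nat.choose]
    ring
  · rw [hμm 4 le_rfl]
    simp [Finset.sum_range_succ, hm₀, Nat.choose]
    ring
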